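/- **Corollary (Exact contraction regularization).** *Setting.* Let $\mathscr X\subseteq\mathbb R^n$ be a Borel set on which derivatives are well defined (for instance an open set), and let $\mathscr F=\{\mathbf w_0,\dots,\mathbf w_{N_f}\}$ be a finite library of fault profiles. Let $p$ be a discrete probability law on training conditions $(\mathbf w,s,t)$ with $\mathbf w\in\mathscr F$, $0\le s\le t$, and let $\nu$ be a probability measure on $[0,1]$ with full support (for instance the uniform law). For every condition of positive $p$-probability let $\rho_s^{\mathbf w},\rho_t^{\mathbf w}$ be probability densities on $\mathscr X$ with finite second moments, let $(\mathbf x_s,\mathbf x_t)\sim\pi_{s,t}^{\mathbf w}$ be a coupling of them, and let $\mathbf z\sim\mathcal N(0,\mathbf I)$ be independent of $(\mathbf x_s,\mathbf x_t)$. Put $I_\tau^{\mathbf w}=a_\tau\mathbf x_s+\beta_\tau\mathbf x_t+\gamma_\tau\mathbf z$ with $a,\beta,\gamma\in C^1([0,1])$, $a_0=\beta_1=1$, $a_1=\beta_0=\gamma_0=\gamma_1=0$; let $\rho_\tau^{\mathbf w}$ be the law of $I_\tau^{\mathbf w}$ and $\mathbf b_\tau^{\mathbf w}(\mathbf x)=\mathbb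 E[\dot I_\tau^{\mathbf w}\mid I_\tau^{\mathbf w}=\mathbf x]$ (a fixed Borel version). Here and below the dependence on $(s,t)$ is suppressed. Let $\widehat\Phi_{\tau_0,\tau_1}^{\mathbf w}:\mathscr X\to\mathscr X$, $\tau_0,\tau_1\in[0,1]$, be the learned maps, $\widehat\Phi_{\tau,\tau}^{\mathbf w}=\mathrm{id}$, with induced field $\widehat{\mathbf b}_\tau^{\mathbf w}(\mathbf x)=\partial_{r}\widehat\Phi_{\tau,r}^{\mathbf w}(\mathbf x)|_{r=\tau}$, so that $\partial_{\tau_1}\widehat\Phi_{\tau_0,\tau_1}^{\mathbf w}(\mathbf x)=\widehat{\mathbf b}_{\tau_1}^{\mathbf w}(\widehat\Phi_{\tau_0,\tau_1}^{\mathbf w}(\mathbf x))$ for $\tau_0\le\tau_1$. Let $\mathbf M^{\mathbf w}(\mathbf x,\tau)=\Theta^{\mathbf w}(\mathbf x,\tau)^\top\Theta^{\mathbf w}(\mathbf x,\tau)$ and $\alpha^{\mathbf w}\in\mathbb R$, and let $$\mathcal R^{\mathbf w}_{\mathrm{ctr}}=\dot{\mathbf M}^{\mathbf w}+(D\widehat{\mathbf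 b}^{\mathbf w}_\tau)^\top\mathbf M^{\mathbf w}+\mathbf M^{\mathbf w}D\widehat{\mathbf b}^{\mathbf w}_\tau-2\alpha^{\mathbf w}\mathbf M^{\mathbf w},\qquad \dot{\mathbf M}^{\mathbf w}=\partial_\tau\mathbf M^{\mathbf w}+\sum_k(\widehat{\mathbf b}^{\mathbf w}_\tau)_k\,\partial_{x_k}\mathbf M^{\mathbf w}.$$ With $[\cdot]_+$ the Frobenius-norm projection onto the cone of symmetric positive semidefinite matrices, the contraction loss is $$\mathcal L_{\mathrm{ctr}}=\mathbb E_{(\mathbf w,s,t)\sim p}\,\mathbb E_{\tau\sim\nu}\,\mathbb E_{\mathbf x\sim\rho_\tau^{\mathbf w}}\bigl\|[\mathcal R^{\mathbf w}_{\mathrm{ctr}}(\mathbf x,\tau)]_+\bigr\|_F^2\in[0,\infty].$$ *Hypotheses.* Fix a condition $(\mathbf w,s,t)$ of positive $p$-probability. Assume that $\tau\mapsto\widehat\Phi_{0,\tau}^{\mathbf w}(\mathbf x)$ is $C^1$ for each $\mathbf x\in\mathscr X$; that $\widehat{\mathbf b}_\tau^{\mathbf w}$ is differentiable on $\mathscr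 X$ for each $\tau\in[0,1]$ and $\Theta^{\mathbf w}$ is differentiable on $\mathscr X\times[0,1]$; that $\mathcal R^{\mathbf w}_{\mathrm{ctr}}$ is continuous on $\mathscr X\times[0,1]$; that for each $\tau\in[0,1]$ the law $\rho_\tau^{\mathbf w}$ is carried by $\mathscr X$ and has full support on $\mathscr X$; that $\underline m^{\mathbf w}\mathbf I\preceq\mathbf M^{\mathbf w}(\mathbf x,\tau)\preceq\overline m^{\mathbf w}\mathbf I$ on $\mathscr X\times[0,1]$ with $\underline m^{\mathbf w}>0$; and that $\overline d^{\mathbf w}:=\sup_{\mathbf x\in\mathscr X,\tau\in[0,1]}\|\mathbf b_\tau^{\mathbf w}(\mathbf x)-\widehat{\mathbf b}_\tau^{\mathbf w}(\mathbf x)\|<\infty$. Define $$\varepsilon_{\mathrm{ctr}}^{\mathbf w}:=\sup_{(\mathbf x,\tau)\in\mathscr X\times[0,1]}\bigl\|[\mathcal R_{\mathrm{ctr}}^{\mathbf w}(\mathbf x,\tau)]_+\bigr\|_F,\quad \tilde\alpha^{\mathbf w}:=\alpha^{\mathbf w}+\frac{\varepsilon_{\mathrm{ctr}}^{\mathbf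 w}}{2\underline m^{\mathbf w}},\quad \tilde\delta_\tau^{\mathbf w}:=\kappa^{\mathbf w}\overline d^{\mathbf w}\int_0^\tau e^{\tilde\alpha^{\mathbf w}(\tau-r)}\,dr,\quad \kappa^{\mathbf w}:=\sqrt{\overline m^{\mathbf w}/\underline m^{\mathbf w}}.$$ *Conclusion.* If $\mathcal L_{\mathrm{ctr}}=0$, then $\varepsilon_{\mathrm{ctr}}^{\mathbf w}=0$, $\tilde\alpha^{\mathbf w}=\alpha^{\mathbf w}$, and for every $\tau\in[0,1]$ $$\tilde\delta_\tau^{\mathbf w}=\kappa^{\mathbf w}\overline d^{\mathbf w}\int_0^\tau e^{\alpha^{\mathbf w}(\tau-r)}\,dr .$$ -/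

import Mathlib

open MeasureTheory ProbabilityTheory Set

noncomputable section

/-- The ambient Euclidean space `ℝⁿ` of the state. -/
abbrev State (n : ℕ) : Type := EuclideanSpace ℝ (Fin n)

/-! ### Frobenius norm and projection onto the positive semidefinite cone -/

/-- The Frobenius norm of a real square matrix. -/
def frobNorm {n : ℕ} (A : Matrix (Fin n) (Fin n) ℝ) : ℝ :=
  Real.sqrt (∑ i, ∑ j, A i j ^ 2)

/-- `P` is a point of the cone of symmetric positive semidefinite matrices that is closest to `A`
in the Frobenius norm. -/
def IsPSDProjection {n : ℕ} (A P : Matrix (Fin n) (Fin n) ℝ) : Prop :=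
  P.PosSemidef ∧ ∀ Q : Matrix (Fin n) (Fin n) ℝ, Q.PosSemidef → frobNorm (A - P) ≤ frobNorm (A - Q)

theorem frobNorm_sq {n : ℕ} (A : Matrix (Fin n) (Fin n) ℝ) :
    frobNorm A ^ 2 = ∑ i, ∑ j, A i j ^ 2 :=
  Real.sq_sqrt (Finset.sum_nonneg fun _ _ => Finset.sum_nonneg fun _ _ => sq_nonneg _)

theorem isClosed_posSemidef {n : ℕ} :
    IsClosed {P : Matrix (Fin n) (Fin n) ℝ | P.PosSemidef} := by
  have h : {P : Matrix (Fin n) (Fin n) ℝ | P.PosSemidef} =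
      {P | P.conjTranspose = P} ∩ ⋂ x : Fin n → ℝ, {P | 0 ≤ star x ⬝ᵥ (P.mulVec x)} := by
    ext P
    simp only [mem_ofPred_eq, mem_inter_iff, mem_iInter]
    rw [Matrix.posSemidef_iff_dotProduct_mulVec]
    rfl
  rw [h]
  refine IsClosed.inter (isClosed_eq (by fun_prop) (by fun_prop)) (isClosed_iInter fun x => ?_)
  exact isClosed_le continuous_const
    (Continuous.dotProduct continuous_const (continuous_id.matrix_mulVec continuous_const))

theorem exists_isPSDProjection {n : ℕ} (A : Matrix (Fin n) (Fin n) ℝ) :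
    ∃ P, IsPSDProjection A P := by
  let _ : NormedAddCommGroup (Matrix (Fin n) (Fin n) ℝ) := Matrix.frobeniusNormedAddCommGroup
  let _ : NormedSpace ℝ (Matrix (Fin n) (Fin n) ℝ) := Matrix.frobeniusNormedSpace
  have _ : ProperSpace (Matrix (Fin n) (Fin n) ℝ) := FiniteDimensional.proper ℝ _
  have hn : ∀ B : Matrix (Fin n) (Fin n) ℝ, ‖B‖ = frobNorm B := fun B => by
    rw [Matrix.frobenius_norm_def, frobNorm, Real.sqrt_eq_rpow]
    simp
  obtain ⟨P, hP, h⟩ := (isClosed_posSemidef (n := n)).exists_infDist_eq_dist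
    ⟨0, Matrix.PosSemidef.zero⟩ A
  refine ⟨P, hP, fun Q hQ => ?_⟩
  rw [← hn, ← hn, ← dist_eq_norm, ← dist_eq_norm, ← h]
  exact Metric.infDist_le_dist_of_mem hQ

/-- The closest point is unique, so that the projection below is the projection. -/
theorem IsPSDProjection.unique {n : ℕ} {A P Q : Matrix (Fin n) (Fin n) ℝ}
    (hP : IsPSDProjection A P) (hQ : IsPSDProjection A Q) : P = Q := by
  have hR : ((2⁻¹ : ℝ) • (P + Q)).PosSemidef := (hP.1.add hQ.1).smul (by norm_num)
  have h0 : ∀ B : Matrix (Fin n) (Fin n) ℝ, 0 ≤ frobNorm B := fun B => Real.sqrt_nonneg _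
  have h1 := pow_le_pow_left₀ (h0 _) (hP.2 _ hR) 2
  have h2 := pow_le_pow_left₀ (h0 _) (hQ.2 _ hR) 2
  have key : 2 * frobNorm (A - (2⁻¹ : ℝ) • (P + Q)) ^ 2 + 2⁻¹ * frobNorm (P - Q) ^ 2 =
      frobNorm (A - P) ^ 2 + frobNorm (A - Q) ^ 2 := by
    simp only [frobNorm_sq, Finset.mul_sum, ← Finset.sum_add_distrib]
    refine Finset.sum_congr rfl fun i _ => Finset.sum_congr rfl fun j _ => ?_
    simp only [Matrix.sub_apply, Matrix.smul_apply, Matrix.add_apply, smul_eq_mul]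
    ring
  have h3 : frobNorm (P - Q) ^ 2 ≤ 0 := by linarith
  rw [frobNorm_sq] at h3
  ext i j
  have h4 : (P - Q) i j ^ 2 ≤ 0 :=
    ((Finset.single_le_sum (f := fun j => (P - Q) i j ^ 2) (fun _ _ => sq_nonneg _)
      (Finset.mem_univ j)).trans
      (Finset.single_le_sum (f := fun i => ∑ j, (P - Q) i j ^ 2)
        (fun _ _ => Finset.sum_nonneg fun _ _ => sq_nonneg _) (Finset.mem_univ i))).trans h3
  have h5 : (P - Q) i j = 0 := by
    have := le_antisymm h4 (sq_nonneg _)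
    exact pow_eq_zero_iff (two_ne_zero) |>.1 this
  exact sub_eq_zero.1 h5

/-- `[A]₊`: the (Frobenius-nearest-point) projection of `A` onto the cone of symmetric positive
semidefinite matrices. -/
def psdProj {n : ℕ} (A : Matrix (Fin n) (Fin n) ℝ) : Matrix (Fin n) (Fin n) ℝ :=
  Classical.choose (exists_isPSDProjection A)

theorem psdProj_spec {n : ℕ} (A : Matrix (Fin n) (Fin n) ℝ) : IsPSDProjection A (psdProj A) :=
  Classical.choose_spec (exists_isPSDProjection A)

/-! ### Densities, couplings and the stochastic interpolant -/

/-- `ρ` is a probability density on `X ⊆ ℝⁿ` with finite second moment. -/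
structure IsAdmissibleDensity {n : ℕ} (X : Set (State n)) (ρ : State n → ℝ) : Prop where
  nonneg : ∀ x ∈ X, 0 ≤ ρ x
  integrable : IntegrableOn ρ X
  integral_eq_one : ∫ x in X, ρ x = 1
  second_moment : IntegrableOn (fun x => ‖x‖ ^ 2 * ρ x) X

/-- The measure `ρ(x) dx` on `X`. -/
def densityMeasure {n : ℕ} (X : Set (State n)) (ρ : State n → ℝ) : Measure (State n) :=
  (volume.restrict X).withDensity fun x => ENNReal.ofReal (ρ x)

/-- `π` is a coupling of `μ` and `ν`. -/
def IsCoupling {n : ℕ} (π : Measure (State n × State n)) (μ ν : Measure (State n)) : Prop :=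
  π.map Prod.fst = μ ∧ π.map Prod.snd = ν

/-- The coefficients of a stochastic interpolant: continuously differentiable on `[0,1]` with the
endpoint conditions that make the interpolant start at `x_s` and end at `x_t`. -/
structure InterpolantSchedule where
  α : ℝ → ℝ
  β : ℝ → ℝ
  γ : ℝ → ℝ
  contDiffOn_α : ContDiffOn ℝ 1 α (Icc 0 1)
  contDiffOn_β : ContDiffOn ℝ 1 β (Icc 0 1)
  contDiffOn_γ : ContDiffOn ℝ 1 γ (Icc 0 1)
  α_zero : α 0 = 1
  α_one : α 1 = 0
  β_zero : β 0 = 0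
  β_one : β 1 = 1
  γ_zero : γ 0 = 0
  γ_one : γ 1 = 0

/-- The law of `((x_s, x_t), z)`, with `(x_s, x_t) ∼ π` and `z` an independent standard Gaussian. -/
def sampleLaw {n : ℕ} (π : Measure (State n × State n)) :
    Measure ((State n × State n) × State n) :=
  π.prod (stdGaussian (State n))

/-- `I_τ = α_τ x_s + β_τ x_t + γ_τ z`. -/
def InterpolantSchedule.path {n : ℕ} (S : InterpolantSchedule) (τ : ℝ)
    (ω : (State n × State n) × State n) : State n :=
  S.α τ • ω.1.1 + S.β τ • ω.1.2 + S.γ τ • ω.2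

/-- The pathwise velocity: the time derivative of `I_τ` (one-sided at `τ = 0, 1`). -/
def InterpolantSchedule.velocity {n : ℕ} (S : InterpolantSchedule) (τ : ℝ)
    (ω : (State n × State n) × State n) : State n :=
  derivWithin S.α (Icc 0 1) τ • ω.1.1 + derivWithin S.β (Icc 0 1) τ • ω.1.2
    + derivWithin S.γ (Icc 0 1) τ • ω.2

/-- The marginal `ρ_τ`: the law of `I_τ`. -/
def InterpolantSchedule.marginal {n : ℕ} (S : InterpolantSchedule)
    (π : Measure (State n × State n)) (τ : ℝ) : Measure (State n) :=
  (sampleLaw π).map (S.path τ)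

/-- `b` is (a Borel version of) the exact auxiliary field
`b_τ(x) = 𝔼[velocity at τ | I_τ = x]`, `τ ∈ [0,1]`. -/
def IsExactField {n : ℕ} (S : InterpolantSchedule) (π : Measure (State n × State n))
    (b : ℝ → State n → State n) : Prop :=
  ∀ τ ∈ Icc (0 : ℝ) 1, Measurable (b τ) ∧
    (fun ω => b τ (S.path τ ω)) =ᵐ[sampleLaw π]
      (sampleLaw π)[S.velocity τ | MeasurableSpace.comap (S.path τ) inferInstance]

/-! ### The learned flow map, the metric and the contraction residual -/

/-- The velocity field induced by a two-time map `Φ`: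
the derivative of `r ↦ Φ_{τ,r}(x)` at `r = τ`. -/
def inducedVelocity {n : ℕ} (Φ : ℝ → ℝ → State n → State n) (τ : ℝ) (x : State n) : State n :=
  derivWithin (fun r => Φ τ r x) (Icc 0 1) τ

/-- `Φ` is a two-time map on `X` over `[0,1]` with `Φ_{τ,τ} = id` that is generated by its induced
velocity field: `∂_{τ₁} Φ_{τ₀,τ₁}(x) = b̂_{τ₁}(Φ_{τ₀,τ₁}(x))`. -/
structure IsGeneratedFlowMap {n : ℕ} (X : Set (State n)) (Φ : ℝ → ℝ → State n → State n) :
    Prop where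
  mapsTo : ∀ τ₀ ∈ Icc (0 : ℝ) 1, ∀ τ₁ ∈ Icc (0 : ℝ) 1, MapsTo (Φ τ₀ τ₁) X X
  refl : ∀ τ ∈ Icc (0 : ℝ) 1, ∀ x ∈ X, Φ τ τ x = x
  hasDeriv : ∀ τ₀ ∈ Icc (0 : ℝ) 1, ∀ τ₁ ∈ Icc τ₀ 1, ∀ x ∈ X,
    HasDerivWithinAt (fun r => Φ τ₀ r x) (inducedVelocity Φ τ₁ (Φ τ₀ τ₁ x)) (Icc 0 1) τ₁

/-- The metric `M = Θᵀ Θ`. -/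
def metricOf {n : ℕ} (Θ : State n → ℝ → Matrix (Fin n) (Fin n) ℝ) (x : State n) (τ : ℝ) :
    Matrix (Fin n) (Fin n) ℝ :=
  (Θ x τ).transpose * Θ x τ

/-- The Jacobian matrix of a vector field on `X`. -/
def jacobian {n : ℕ} (X : Set (State n)) (v : State n → State n) (x : State n) :
    Matrix (Fin n) (Fin n) ℝ :=
  Matrix.of fun i j => fderivWithin ℝ v X x (EuclideanSpace.single j 1) i

/-- The total derivative `∂_τ M + ∑ₖ v_k ∂_{x_k} M` of `M` along the flow of the field `v`. -/
def metricDot {n : ℕ} (X : Set (State n)) (M : State n → ℝ → Matrix (Fin n) (Fin n) ℝ)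
    (v : ℝ → State n → State n) (x : State n) (τ : ℝ) : Matrix (Fin n) (Fin n) ℝ :=
  Matrix.of fun i j =>
    fderivWithin ℝ (fun q : State n × ℝ => M q.1 q.2 i j) (X ×ˢ Icc (0 : ℝ) 1) (x, τ) (v τ x, 1)

/-- The contraction residual `Ṁ + (Dv)ᵀ M + M Dv - 2 α M`. -/
def ctrResidual {n : ℕ} (X : Set (State n)) (M : State n → ℝ → Matrix (Fin n) (Fin n) ℝ)
    (v : ℝ → State n → State n) (α : ℝ) (x : State n) (τ : ℝ) : Matrix (Fin n) (Fin n) ℝ :=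
  metricDot X M v x τ + (jacobian X (v τ) x).transpose * M x τ + M x τ * jacobian X (v τ) x
    - (2 * α) • M x τ

/-- A training condition: the index of a fault profile of the library `{w₀, …, w_{N_f}}`, and a pair
`(s, t)` of physical endpoints. -/
abbrev Condition (Nf : ℕ) : Type := Fin (Nf + 1) × ℝ × ℝ

/-- The contraction residual of the condition `c = (w, s, t)`: metric `Θᵀ Θ` and rate `α` of the
fault profile `w`, and field induced by the learned map of the condition. -/
def learnedResidual {n Nf : ℕ} (X : Set (State n))
    (Θ : Fin (Nf + 1) → State n → ℝ → Matrix (Fin n) (Fin n) ℝ)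
    (Φ : Condition Nf → ℝ → ℝ → State n → State n) (α : Fin (Nf + 1) → ℝ) (c : Condition Nf) :
    State n → ℝ → Matrix (Fin n) (Fin n) ℝ :=
  ctrResidual X (metricOf (Θ c.1)) (inducedVelocity (Φ c)) (α c.1)

/-- The contraction loss `𝔼 ‖[R^w(x, τ)]₊‖_F²`, as an extended nonnegative number: the
condition `c` is drawn from `p`, the auxiliary time `τ` from `ν`, and then `x` from the interpolant
marginal `ρ_τ` of the condition `c`. -/
def ctrLoss {n Nf : ℕ} (S : InterpolantSchedule) (p : PMF (Condition Nf)) (ν : Measure ℝ)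
    (π : Condition Nf → Measure (State n × State n))
    (R : Condition Nf → State n → ℝ → Matrix (Fin n) (Fin n) ℝ) : ENNReal :=
  ∑' c, p c * ∫⁻ τ, ∫⁻ x, ENNReal.ofReal (frobNorm (psdProj (R c x τ)) ^ 2)
    ∂(S.marginal (π c) τ) ∂ν

/-- `ε_ctr = sup over X × [0,1] of ‖[R(x, τ)]₊‖_F`, in `[0, ∞]`. -/
def epsCtr {n : ℕ} (X : Set (State n)) (R : State n → ℝ → Matrix (Fin n) (Fin n) ℝ) : ENNReal :=
  ⨆ x ∈ X, ⨆ τ ∈ Icc (0 : ℝ) 1, ENNReal.ofReal (frobNorm (psdProj (R x τ)))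

/-- The corrected rate `α̃ = α + ε / (2 m)`, meaningful when `ε < ∞`. -/
def alphaTilde (α : ℝ) (ε : ENNReal) (m : ℝ) : ℝ :=
  α + ε.toReal / (2 * m)

/-- `d̄ = sup over X × [0,1] of ‖b_τ(x) - b̂_τ(x)‖`, in `[0, ∞]`. -/
def perturbationLevel {n : ℕ} (X : Set (State n)) (b bhat : ℝ → State n → State n) : ENNReal :=
  ⨆ x ∈ X, ⨆ τ ∈ Icc (0 : ℝ) 1, ENNReal.ofReal ‖b τ x - bhat τ x‖

/-- The bias term `κ d̄ ∫₀^τ e^{a (τ - r)} dr` with rate `a`, where `κ = √(m̄ / m)`. -/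
def biasTerm (mlo mhi d a τ : ℝ) : ℝ :=
  Real.sqrt (mhi / mlo) * d * ∫ r in (0 : ℝ)..τ, Real.exp (a * (τ - r))

end

/-!
The clipped residual norm `g (x, τ) = ‖[R (x, τ)]₊‖_F` is continuous on `X × [0,1]`, and the loss
integrates `g²` against the measure `ρ_τ(dx) ν(dτ)`, which charges every nonempty relatively
open subset of `X × [0,1]`; hence a vanishing loss forces `g = 0` everywhere, that is
`ε_ctr = 0`, and the assertions on `α̃` and on the bias term follow by substitution.

Continuity of `A ↦ ‖[A]₊‖_F` comes from the cone identity
`‖[A]₊‖_F² = ‖A‖_F² - dist(A, cone)²` (`frobNorm_psdProj_sq`).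

If `g (x₀, τ₀) > 0`, then `g² > η > 0` on a relative neighbourhood `U × V`. The marginals `ρ_τ` do
not necessarily have densities, but `τ ↦ I_τ` is pathwise continuous, so the positive mass
`ρ_{τ₀}(U)` gives a lower bound `ρ_τ(U) ≥ δ > 0` uniform in `τ` near `τ₀`
(`InterpolantSchedule.exists_pos_le_marginal`). The loss is therefore at least
`p(c) η δ ν(V') > 0` for a smaller neighbourhood `V'` of `τ₀`. This bound uses only indicators of
measurable sets, so the measurability of `τ ↦ ∫ g² dρ_τ` plays no role.
-/

/-- The nearest point `P` of the cone satisfies `⟨A - P, P⟩ = 0`, since `t • P` stays in the cone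
for all `t ≥ 0`; this is Pythagoras for the decomposition `A = P + (A - P)`. -/
theorem IsPSDProjection.frobNorm_sq_eq {n : ℕ} {A P : Matrix (Fin n) (Fin n) ℝ}
    (h : IsPSDProjection A P) : frobNorm P ^ 2 = frobNorm A ^ 2 - frobNorm (A - P) ^ 2 := by
  set c : ℝ := ∑ i, ∑ j, (A i j - P i j) * P i j with hc
  have hA : frobNorm A ^ 2 = frobNorm (A - P) ^ 2 + 2 * c + frobNorm P ^ 2 := by
    simp only [frobNorm_sq, hc, Finset.mul_sum, ← Finset.sum_add_distrib]
    refine Finset.sum_congr rfl fun i _ => Finset.sum_congr rfl fun j _ => ?_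
    simp only [Matrix.sub_apply]
    ring
  have hvar : ∀ s : ℝ, -1 ≤ s → 0 ≤ s ^ 2 * frobNorm P ^ 2 - 2 * s * c := by
    intro s hs
    have hle := pow_le_pow_left₀ (Real.sqrt_nonneg _)
      (h.2 ((1 + s) • P) (h.1.smul (by linarith))) 2
    have hexp : frobNorm (A - (1 + s) • P) ^ 2 =
        frobNorm (A - P) ^ 2 + (s ^ 2 * frobNorm P ^ 2 - 2 * s * c) := by
      simp only [frobNorm_sq, hc, Finset.mul_sum, ← Finset.sum_add_distrib,
        ← Finset.sum_sub_distrib]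
      refine Finset.sum_congr rfl fun i _ => Finset.sum_congr rfl fun j _ => ?_
      simp only [Matrix.sub_apply, Matrix.smul_apply, smul_eq_mul]
      ring
    change frobNorm (A - P) ^ 2 ≤ _ at hle
    linarith
  have hc0 : c = 0 := by
    have hp := sq_nonneg (frobNorm P)
    set q := frobNorm P ^ 2
    have hq : 0 < q + 1 := by linarith
    -- The quadratic `s² q - 2 s c` is tested at a small multiple of `c`, of modulus at most `1`.
    have hu : 0 < q + 1 + |c| := by positivity
    have hs : -1 ≤ c / (q + 1 + |c|) := by
      rw [le_div_iff₀ hu]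
      linarith [neg_abs_le c]
    have h1 := hvar _ hs
    have h2 : (c / (q + 1 + |c|)) ^ 2 * q - 2 * (c / (q + 1 + |c|)) * c =
        -(c ^ 2 * (q + 2 + 2 * |c|)) / (q + 1 + |c|) ^ 2 := by
      field_simp
      ring
    rw [h2, le_div_iff₀ (by positivity)] at h1
    have h3 : c ^ 2 * 1 ≤ c ^ 2 * (q + 2 + 2 * |c|) :=
      mul_le_mul_of_nonneg_left (by linarith [abs_nonneg c]) (sq_nonneg c)
    exact pow_eq_zero_iff two_ne_zero |>.1 (le_antisymm (by linarith) (sq_nonneg c))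
  rw [hA, hc0]
  ring

theorem frobNorm_psdProj_sq {n : ℕ} (A : Matrix (Fin n) (Fin n) ℝ) :
    frobNorm (psdProj A) ^ 2 = frobNorm A ^ 2 - frobNorm (A - psdProj A) ^ 2 :=
  (psdProj_spec A).frobNorm_sq_eq

/-- The distance to the positive semidefinite cone is continuous. -/
theorem continuous_frobNorm_sub_psdProj {n : ℕ} :
    Continuous fun A : Matrix (Fin n) (Fin n) ℝ => frobNorm (A - psdProj A) := by
  let _ : NormedAddCommGroup (Matrix (Fin n) (Fin n) ℝ) := Matrix.frobeniusNormedAddCommGroup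
  have hn : ∀ B : Matrix (Fin n) (Fin n) ℝ, ‖B‖ = frobNorm B := fun B => by
    rw [Matrix.frobenius_norm_def, frobNorm, Real.sqrt_eq_rpow]
    simp
  have heq : (fun A : Matrix (Fin n) (Fin n) ℝ => frobNorm (A - psdProj A)) =
      fun A => Metric.infDist A {P | P.PosSemidef} := by
    funext A
    refine le_antisymm ?_ ?_
    · refine (Metric.le_infDist ⟨0, Matrix.PosSemidef.zero⟩).2 fun {Q} hQ => ?_
      rw [dist_eq_norm, hn]
      exact (psdProj_spec A).2 Q hQ
    · rw [← hn, ← dist_eq_norm]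
      exact Metric.infDist_le_dist_of_mem (psdProj_spec A).1
  rw [heq]
  exact Metric.continuous_infDist_pt _

theorem continuous_frobNorm_psdProj_sq {n : ℕ} :
    Continuous fun A : Matrix (Fin n) (Fin n) ℝ => frobNorm (psdProj A) ^ 2 := by
  simp only [frobNorm_psdProj_sq]
  refine Continuous.sub ?_ (continuous_frobNorm_sub_psdProj.pow 2)
  simp only [frobNorm_sq]
  fun_prop

theorem InterpolantSchedule.measurable_path {n : ℕ} (S : InterpolantSchedule) (τ : ℝ) :
    Measurable (S.path (n := n) τ) := by
  unfold InterpolantSchedule.path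
  fun_prop

theorem InterpolantSchedule.continuousOn_path {n : ℕ} (S : InterpolantSchedule)
    (ω : (State n × State n) × State n) : ContinuousOn (fun τ => S.path τ ω) (Icc 0 1) := by
  unfold InterpolantSchedule.path
  have h1 := S.contDiffOn_α.continuousOn
  have h2 := S.contDiffOn_β.continuousOn
  have h3 := S.contDiffOn_γ.continuousOn
  fun_prop

/-- If `ρ_{τ₀}` charges the open set `U`, then the `ρ_τ` charge it uniformly for `τ` near `τ₀`: by
continuity of paths, the event `I_{τ₀} ∈ U` is covered by the events that `I_τ ∈ U` for all `τ`
within `1 / (k + 1)` of `τ₀`, so one of these has positive (outer) probability. -/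
theorem InterpolantSchedule.exists_pos_le_marginal {n : ℕ} (S : InterpolantSchedule)
    (π : Measure (State n × State n)) {τ₀ : ℝ} (hτ₀ : τ₀ ∈ Icc (0 : ℝ) 1) {U : Set (State n)}
    (hU : IsOpen U) (hpos : S.marginal π τ₀ U ≠ 0) :
    ∃ r > 0, ∃ δ : ENNReal, δ ≠ 0 ∧
      ∀ τ ∈ Metric.ball τ₀ r ∩ Icc 0 1, δ ≤ S.marginal π τ U := by
  let A : ℕ → Set ((State n × State n) × State n) := fun k =>
    {ω | ∀ τ ∈ Metric.ball τ₀ (1 / ((k : ℝ) + 1)) ∩ Icc 0 1, S.path τ ω ∈ U}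
  have hcover : S.path τ₀ ⁻¹' U ⊆ ⋃ k, A k := by
    intro ω hω
    have hnear : {τ | S.path τ ω ∈ U} ∈ nhdsWithin τ₀ (Icc 0 1) :=
      S.continuousOn_path ω τ₀ hτ₀ (hU.mem_nhds hω)
    obtain ⟨r, hr, hrU⟩ := Metric.mem_nhdsWithin_iff.1 hnear
    obtain ⟨k, hk⟩ := exists_nat_one_div_lt hr
    exact mem_iUnion.2 ⟨k, fun τ hτ => hrU ⟨Metric.ball_subset_ball hk.le hτ.1, hτ.2⟩⟩
  have hex : ∃ k, sampleLaw π (A k) ≠ 0 := by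
    by_contra! hnull
    refine hpos ?_
    rw [InterpolantSchedule.marginal, Measure.map_apply (S.measurable_path τ₀) hU.measurableSet]
    exact measure_mono_null hcover (measure_iUnion_null hnull)
  obtain ⟨k, hk⟩ := hex
  refine ⟨1 / ((k : ℝ) + 1), by positivity, _, hk, fun τ hτ => ?_⟩
  rw [InterpolantSchedule.marginal, Measure.map_apply (S.measurable_path τ) hU.measurableSet]
  exact measure_mono fun ω hω => hω τ hτ

/-- A nonnegative function, continuous on `X × [0,1]`, that is positive somewhere on this set has a
positive iterated (lower) integral against marginals of full support and `ν` of full support. -/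
theorem InterpolantSchedule.lintegral_marginal_ne_zero {n : ℕ} (S : InterpolantSchedule)
    (π : Measure (State n × State n)) {X : Set (State n)} (hX : MeasurableSet X)
    (hmass : ∀ τ ∈ Icc (0 : ℝ) 1, S.marginal π τ Xᶜ = 0)
    (hfull : ∀ τ ∈ Icc (0 : ℝ) 1, X ⊆ (S.marginal π τ).support)
    {ν : Measure ℝ} (hν : ν.support = Icc (0 : ℝ) 1) {f : State n → ℝ → ℝ}
    (hf : ContinuousOn (fun q : State n × ℝ => f q.1 q.2) (X ×ˢ Icc (0 : ℝ) 1))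
    {x₀ : State n} (hx₀ : x₀ ∈ X) {τ₀ : ℝ} (hτ₀ : τ₀ ∈ Icc (0 : ℝ) 1) (hpos : 0 < f x₀ τ₀) :
    ∫⁻ τ, ∫⁻ x, ENNReal.ofReal (f x τ) ∂(S.marginal π τ) ∂ν ≠ 0 := by
  obtain ⟨η, hη, hηf⟩ := exists_between hpos
  have hnear : {q : State n × ℝ | η < f q.1 q.2} ∈
      nhdsWithin (x₀, τ₀) (X ×ˢ Icc (0 : ℝ) 1) :=
    hf (x₀, τ₀) ⟨hx₀, hτ₀⟩ (lt_mem_nhds hηf)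
  obtain ⟨r, hr, hrf⟩ := Metric.mem_nhdsWithin_iff.1 hnear
  have hU : S.marginal π τ₀ (Metric.ball x₀ r) ≠ 0 :=
    ((Measure.mem_support_iff_forall x₀).1 (hfull τ₀ hτ₀ hx₀) _ (Metric.ball_mem_nhds x₀ hr)).ne'
  obtain ⟨r', hr', δ, hδ, hδU⟩ := S.exists_pos_le_marginal π hτ₀ Metric.isOpen_ball hU
  set V : Set ℝ := Metric.ball τ₀ (min r r') ∩ Icc 0 1 with hVdef
  have hVmeas : MeasurableSet V := measurableSet_ball.inter measurableSet_Icc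
  have hνV : ν V ≠ 0 := by
    have h0 : ν (Icc (0 : ℝ) 1)ᶜ = 0 := by
      rw [← hν]
      exact Measure.measure_compl_support
    rw [hVdef, measure_inter_conull h0]
    refine ((Measure.mem_support_iff_forall τ₀).1 (hν ▸ hτ₀) _
      (Metric.ball_mem_nhds τ₀ (lt_min hr hr'))).ne'
  have hinner : ∀ τ ∈ V, ENNReal.ofReal η * δ ≤
      ∫⁻ x, ENNReal.ofReal (f x τ) ∂(S.marginal π τ) := by
    intro τ hτ
    have hW : MeasurableSet (Metric.ball x₀ r ∩ X) := measurableSet_ball.inter hX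
    calc ENNReal.ofReal η * δ
        ≤ ENNReal.ofReal η * S.marginal π τ (Metric.ball x₀ r ∩ X) := by
          rw [measure_inter_conull (hmass τ hτ.2)]
          gcongr
          exact hδU τ ⟨Metric.ball_subset_ball (min_le_right _ _) hτ.1, hτ.2⟩
      _ = ∫⁻ _ in Metric.ball x₀ r ∩ X, ENNReal.ofReal η ∂(S.marginal π τ) :=
          (setLIntegral_const _ _).symm
      _ ≤ ∫⁻ x in Metric.ball x₀ r ∩ X, ENNReal.ofReal (f x τ) ∂(S.marginal π τ) := by
          refine setLIntegral_mono' hW fun x hx => ENNReal.ofReal_le_ofReal (le_of_lt ?_)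
          refine hrf (show (x, τ) ∈ _ from ⟨?_, hx.2, hτ.2⟩)
          rw [← ball_prod_same]
          exact ⟨hx.1, Metric.ball_subset_ball (min_le_left _ _) hτ.1⟩
      _ ≤ ∫⁻ x, ENNReal.ofReal (f x τ) ∂(S.marginal π τ) := setLIntegral_le_lintegral _ _
  refine ne_of_gt (lt_of_lt_of_le (b := ENNReal.ofReal η * δ * ν V) ?_ ?_)
  · exact pos_iff_ne_zero.2
      (mul_ne_zero (mul_ne_zero (ENNReal.ofReal_pos.2 hη).ne' hδ) hνV)
  · rw [← setLIntegral_const]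
    exact (setLIntegral_mono' hVmeas hinner).trans (setLIntegral_le_lintegral _ _)

theorem mainTheorem8 {n Nf : ℕ}
    -- the state space
    (X : Set (State n)) (hXmeas : MeasurableSet X) (hXdiff : UniqueDiffOn ℝ X)
    -- the interpolant, the sampling laws of the conditions `(w, s, t)` and of the auxiliary time
    (S : InterpolantSchedule) (p : PMF (Condition Nf))
    (hp : ∀ c ∈ p.support, 0 ≤ c.2.1 ∧ c.2.1 ≤ c.2.2)
    (ν : Measure ℝ) [IsProbabilityMeasure ν]
    (hνsupp : ν.support = Icc (0 : ℝ) 1)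
    -- the densities `ρ_t^w` and the couplings of `ρ_s^w` and `ρ_t^w`
    (ρ : Fin (Nf + 1) → ℝ → State n → ℝ)
    (hρ : ∀ c ∈ p.support, IsAdmissibleDensity X (ρ c.1 c.2.1) ∧ IsAdmissibleDensity X (ρ c.1 c.2.2))
    (π : Condition Nf → Measure (State n × State n))
    (hπ : ∀ c ∈ p.support,
      IsCoupling (π c) (densityMeasure X (ρ c.1 c.2.1)) (densityMeasure X (ρ c.1 c.2.2)))
    -- the learned maps, the metric factors and the rates
    (Φ : Condition Nf → ℝ → ℝ → State n → State n)
    (Θ : Fin (Nf + 1) → State n → ℝ → Matrix (Fin n) (Fin n) ℝ)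
    (α : Fin (Nf + 1) → ℝ)
    -- the fixed fault profile, with a pair of endpoints, and the hypotheses on it
    (c : Condition Nf) (hc : c ∈ p.support)
    (hΦ : IsGeneratedFlowMap X (Φ c))
    (hΦC1 : ∀ x ∈ X, ContDiffOn ℝ 1 (fun τ => Φ c 0 τ x) (Icc 0 1))
    (hvdiff : ∀ τ ∈ Icc (0 : ℝ) 1, DifferentiableOn ℝ (inducedVelocity (Φ c) τ) X)
    (hΘdiff : ∀ i j, DifferentiableOn ℝ (fun q : State n × ℝ => Θ c.1 q.1 q.2 i j)
      (X ×ˢ Icc (0 : ℝ) 1))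
    (hRcont : ContinuousOn (fun q : State n × ℝ => learnedResidual X Θ Φ α c q.1 q.2)
      (X ×ˢ Icc (0 : ℝ) 1))
    (hmass : ∀ τ ∈ Icc (0 : ℝ) 1, S.marginal (π c) τ Xᶜ = 0)
    (hfull : ∀ τ ∈ Icc (0 : ℝ) 1, X ⊆ (S.marginal (π c) τ).support)
    (mlo mhi : ℝ) (hmlo : 0 < mlo)
    (hM : ∀ x ∈ X, ∀ τ ∈ Icc (0 : ℝ) 1,
      (metricOf (Θ c.1) x τ - mlo • (1 : Matrix (Fin n) (Fin n) ℝ)).PosSemidef ∧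
      (mhi • (1 : Matrix (Fin n) (Fin n) ℝ) - metricOf (Θ c.1) x τ).PosSemidef)
    (b : ℝ → State n → State n) (hb : IsExactField S (π c) b)
    (hd : perturbationLevel X b (inducedVelocity (Φ c)) < ⊤)
    -- the contraction loss vanishes
    (hloss : ctrLoss S p ν π (learnedResidual X Θ Φ α) = 0) :
    epsCtr X (learnedResidual X Θ Φ α c) = 0 ∧
    alphaTilde (α c.1) (epsCtr X (learnedResidual X Θ Φ α c)) mlo = α c.1 ∧
    ∀ τ ∈ Icc (0 : ℝ) 1,
      biasTerm mlo mhi (perturbationLevel X b (inducedVelocity (Φ c))).toReal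
          (alphaTilde (α c.1) (epsCtr X (learnedResidual X Θ Φ α c)) mlo) τ =
        biasTerm mlo mhi (perturbationLevel X b (inducedVelocity (Φ c))).toReal (α c.1) τ := by
  have hzero : ∀ x ∈ X, ∀ τ ∈ Icc (0 : ℝ) 1,
      frobNorm (psdProj (learnedResidual X Θ Φ α c x τ)) ^ 2 = 0 := by
    intro x hx τ hτ
    by_contra hne
    have hterm := ENNReal.tsum_eq_zero.1 hloss c
    refine S.lintegral_marginal_ne_zero (π c) hXmeas hmass hfull hνsupp
      (f := fun x τ => frobNorm (psdProj (learnedResidual X Θ Φ α c x τ)) ^ 2)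
      (continuous_frobNorm_psdProj_sq.comp_continuousOn hRcont) hx hτ
      (lt_of_le_of_ne (sq_nonneg _) (Ne.symm hne)) ?_
    exact (mul_eq_zero.1 hterm).resolve_left ((p.mem_support_iff c).1 hc)
  have heps : epsCtr X (learnedResidual X Θ Φ α c) = 0 := by
    simp only [epsCtr, ENNReal.iSup_eq_zero]
    intro x hx τ hτ
    rw [pow_eq_zero_iff two_ne_zero |>.1 (hzero x hx τ hτ), ENNReal.ofReal_zero]
  have halpha : alphaTilde (α c.1) (epsCtr X (learnedResidual X Θ Φ α c)) mlo = α c.1 := by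
    simp [alphaTilde, heps]
  exact ⟨heps, halpha, fun τ _ => by rw [halpha]⟩
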